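/- **Model.** There are $N$ agents and a real number $\mu$. At time $t=0,1,2,\dots$ agent $i$ observes $o_{i,t}$, where all $o_{i,t}$ are independent with law $\mathcal N(\mu,\sigma^2)$, $\sigma>0$. The private belief of agent $i$ at time $t\ge 1$ has mean $\hat\mu_{i,t}=\frac1t\sum_{s<t}o_{i,s}$, and its precision is $p_{i,t}=t\sigma^{-2}$. Given a sequence $\mathbf W(t)$ ($t=0,1,\dots$) of nonnegative real $N\times N$ trust matrices, the precision vector $\mathbf q_t$ and the mean vector $\hat{\boldsymbol\nu}_t$ of the aggregate beliefs are defined, from given deterministic initial values $\mathbf q_0\ge 0$ (for instance $\mathbf q_0=0$) and $\hat{\boldsymbol\nu}_0\in\mathbb R^N$, by $$\mathbf q_{t+1}=\mathbf p_{t+1}+\mathbf W(t)\mathbf q_t,\qquad \hat{\boldsymbol\nu}_{t+1}\odot\mathbf q_{t+1}=\hat{\boldsymbol\mu}_{t+1}\odot\mathbf p_{t+1}+\mathbf W(t)\,(\hat{\boldsymbol\nu}_t\odot\mathbf q_t),$$ where $\odot$ is the entrywise product. **Theorem.** There exists a positive-valued function $h(\cdot,\cdot,\cdot,\cdot,\cdot)$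 with the following property. Let $c>1$, $0<L<U<\infty$, $\delta>0$, $\epsilon>0$, $\psi>0$, let $\mathbf W(0)$ be any nonnegative $N\times N$ matrix and let $\mathbf W(t)$ ($t=1,2,\dots$) be nonnegative primitive $N\times N$ matrices such that, for all $t\ge 1$: 1. $\lVert \mathbf W(t+1)-\mathbf W(t)\rVert_1\le\epsilon$, where $\lVert\cdot\rVert_1$ is the matrix norm induced by the $\ell^1$ norm (the largest absolute column sum); 2. the spectral radius satisfies $\rho(\mathbf W(t))\ge c$; 3. every nonzero entry of $\mathbf W(t)$ lies in $[L,U]$; 4. every complex eigenvalue of $\mathbf W(t)$ other than the leading eigenvalue $\rho(\mathbf W(t))$ has modulus at most $\rho(\mathbf W(t))-\delta$; 5. $\left\lvert \frac{\mathbf v(t+1)}{\lvert \mathbf v(t+1)\rvert_1}-\frac{\mathbf v(t)}{\lvert \mathbf v(t)\rvert_1}\right\rvert_1\le\psi$, where $\mathbf v(t)$ is a Perron vector of $\mathbf W(t)$, i.e. an entrywise positive vector with $\mathbf W(t)\mathbf v(t)=\rho(\mathbf W(t))\mathbf v(t)$, and $\lvert\cdot\rvert_1$ is the $\ell^1$ norm.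 If $\epsilon,\psi<h(c,L,U,N,\delta)$, then for every $i\in\{1,\dots,N\}$ $$\Pr\Big[\lim_{t\to\infty}\hat\nu_{i,t}=\mu\Big]=0 .$$ -/

import Mathlib

open MeasureTheory ProbabilityTheory Filter Topology

namespace LockIn

/-- The spectral radius of a real square matrix: the largest modulus of its complex eigenvalues. -/
noncomputable def rho {N : ℕ} (A : Matrix (Fin N) (Fin N) ℝ) : ℝ :=
  (spectralRadius ℂ (A.map (fun x : ℝ => (x : ℂ)))).toReal

/-- The `ℓ¹` norm of a vector. -/
noncomputable def vecNorm1 {N : ℕ} (v : Fin N → ℝ) : ℝ :=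
  ∑ i, |v i|

/-- The matrix norm induced by the `ℓ¹` norm, i.e. the largest absolute column sum. -/
noncomputable def matNorm1 {N : ℕ} (A : Matrix (Fin N) (Fin N) ℝ) : ℝ :=
  ⨆ j, ∑ i, |A i j|

/-- `v` is a Perron vector of `A`: an entrywise positive (right) eigenvector for the eigenvalue
`ρ(A)`. For a primitive matrix it is unique up to a positive factor. -/
def IsPerronVector {N : ℕ} (A : Matrix (Fin N) (Fin N) ℝ) (v : Fin N → ℝ) : Prop :=
  (∀ i, 0 < v i) ∧ A.mulVec v = rho A • v

/-- All eigenvalues of `A` other than the leading eigenvalue `ρ(A)` have modulus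
at most `ρ(A) - δ`. -/
def HasSpectralGap {N : ℕ} (A : Matrix (Fin N) (Fin N) ℝ) (δ : ℝ) : Prop :=
  ∀ z ∈ spectrum ℂ (A.map (fun x : ℝ => (x : ℂ))), z ≠ (rho A : ℂ) → ‖z‖ ≤ rho A - δ

/-- The precision `p_t = t σ⁻²` of a private belief. -/
noncomputable def privPrec (σ : ℝ) (t : ℕ) : ℝ :=
  t * (σ ^ 2)⁻¹

/-- The mean `μ̂_t` of the private belief of each agent after `t` observations: the average of
`o_0, …, o_{t-1}`. -/
noncomputable def privMean {N : ℕ} (o : ℕ → Fin N → ℝ) (t : ℕ) : Fin N → ℝ :=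
  fun i => (∑ s ∈ Finset.range t, o s i) / t

/-- The precision vector `q_t` of the aggregate beliefs, `q_{t+1} = p_{t+1} + W(t) q_t`,
started at `q0`. -/
noncomputable def aggPrec {N : ℕ} (σ : ℝ) (W : ℕ → Matrix (Fin N) (Fin N) ℝ)
    (q0 : Fin N → ℝ) : ℕ → Fin N → ℝ
  | 0 => q0
  | t + 1 => fun i => privPrec σ (t + 1) + (W t).mulVec (aggPrec σ W q0 t) i

/-- The mean vector `ν̂_t` of the aggregate beliefs, started at `ν0`, where
`ν̂_{t+1} ⊙ q_{t+1} = μ̂_{t+1} ⊙ p_{t+1} + W(t) (ν̂_t ⊙ q_t)`. (If `σ > 0` and `W`, `q0` are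
nonnegative, then `q_{t+1}` is positive.) -/
noncomputable def aggMean {N : ℕ} (σ : ℝ) (W : ℕ → Matrix (Fin N) (Fin N) ℝ)
    (q0 ν0 : Fin N → ℝ) (o : ℕ → Fin N → ℝ) : ℕ → Fin N → ℝ
  | 0 => ν0
  | t + 1 => fun i =>
      (privMean o (t + 1) i * privPrec σ (t + 1) +
        (W t).mulVec (fun j => aggMean σ W q0 ν0 o t j * aggPrec σ W q0 t j) i) /
      aggPrec σ W q0 (t + 1) i

end LockIn

/-!
The error of agent `i` at time `t` is an affine function of all observations, and the coefficient
of the single observation `o 0 j` in `ν̂_{i,t} - μ` is `σ⁻² k_{i,t} / q_{i,t}`, where `k` is the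
`influence` sequence `k_{t+1} = e_j + W(t) k_t`, `k_0 = 0`. If for one `j` this coefficient does not
tend to `0`, then, all the other observations being fixed, at most one value of `o 0 j` is
compatible with `ν̂_{i,t} → μ`. As `o 0 j` has no atoms and is independent of the other observations,
Fubini's theorem gives probability zero (`measure_eq_zero_of_subsingleton_update`).

Such a `j` exists as soon as `q_{i,t} ≤ C k_{i,t}` for the influence `k` of the all-ones vector, which
is the sum over `j` of the influences above. This bound holds because `k` grows geometrically
(`influence_one_ge`): if `u(t)` is the Perron vector normalized to have sum `1`, its entries are
bounded below by a constant depending only on `L`, `U`, `N` (`perron_lower_bound`), so a small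
`ℓ¹` change of `u` costs only a factor close to `1`, and `W(t) u(t) ≥ c u(t) ≥ κ u(t+1)` with
`κ = (c + 1) / 2 > 1`. Comparing the two recursions, the best constant `C_t` in `q_t ≤ C_t k_t`
increases at each step by at most a multiple of `(t + 1) / κ ^ t`, which is summable
(`exists_aggPrec_le_mul_influence`).
-/

namespace LockIn

/-! ### Lower bounds for the entries of a Perron vector -/

/-- A primitive matrix has a nonzero entry leading from any proper nonempty set of indices to its
complement, since otherwise its powers would all have the same block of zeros. -/
lemma exists_ne_zero_of_isPrimitive {n : Type*} [Fintype n] [DecidableEq n] {A : Matrix n n ℝ}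
    (hA : A.IsPrimitive) {S : Finset n} (hS : S.Nonempty) (hS' : S ≠ Finset.univ) :
    ∃ i ∉ S, ∃ j ∈ S, A i j ≠ 0 := by
  by_contra! hzero
  have hpow : ∀ k : ℕ, ∀ i ∉ S, ∀ j ∈ S, (A ^ k) i j = 0 := by
    intro k
    induction k with
    | zero =>
      intro i hi j hj
      rw [pow_zero, Matrix.one_apply_ne]
      rintro rfl
      exact hi hj
    | succ k ih =>
      intro i hi j hj
      rw [pow_succ, Matrix.mul_apply]
      refine Finset.sum_eq_zero fun l _ => ?_
      by_cases hl : l ∈ S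
      · rw [ih i hi l hl, zero_mul]
      · rw [hzero l hl j hj, mul_zero]
  obtain ⟨k, -, hk⟩ := hA.exists_pos_pow
  obtain ⟨j, hj⟩ := hS
  obtain ⟨i, hi⟩ : ∃ i, i ∉ S := by
    by_contra! h
    exact hS' (Finset.eq_univ_iff_forall.2 h)
  exact (hk i j).ne' (hpow k i hi j hj)

/-- The sets `{i | r ^ k / N ≤ u i}` grow with `k` until they exhaust all indices: an edge leading
out of such a set loses at most the factor `r = L / (N U)`, because `ρ ≤ N U`. -/
lemma perron_lower_bound {N : ℕ} {A : Matrix (Fin N) (Fin N) ℝ} {L U ρ : ℝ} (hL : 0 < L)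
    (hLU : L < U) (hA : A.IsPrimitive)
    (hentry : ∀ i j, A i j ≠ 0 → L ≤ A i j ∧ A i j ≤ U)
    {u : Fin N → ℝ} (hu : ∀ i, 0 < u i) (hsum : ∑ i, u i = 1) (heig : A.mulVec u = ρ • u)
    (i : Fin N) : (L / (N * U)) ^ N / N ≤ u i := by
  have hU : 0 < U := hL.trans hLU
  have hN1 : 1 ≤ N := Nat.one_le_of_lt i.isLt
  have hNR : (1 : ℝ) ≤ N := by exact_mod_cast hN1
  have hNU : 0 < N * U := by positivity
  have heig' : ∀ i, ∑ j, A i j * u j = ρ * u i := fun i => congrFun heig i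
  have hρle : ρ ≤ N * U := by
    calc ρ = ∑ i, ρ * u i := by rw [← Finset.mul_sum, hsum, mul_one]
      _ = ∑ i, ∑ j, A i j * u j := by simp_rw [heig']
      _ ≤ ∑ _i : Fin N, ∑ j, U * u j := by
          refine Finset.sum_le_sum fun i _ => Finset.sum_le_sum fun j _ => ?_
          refine mul_le_mul_of_nonneg_right ?_ (hu j).le
          by_cases h : A i j = 0
          · rw [h]; exact hU.le
          · exact (hentry i j h).2
      _ = N * U := by simp [← Finset.mul_sum, hsum]
  set r : ℝ := L / (N * U) with hr
  have hr0 : 0 < r := by positivity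
  have hr1 : r ≤ 1 := by
    rw [hr, div_le_one hNU]
    nlinarith
  have hedge : ∀ i j, A i j ≠ 0 → r * u j ≤ u i := by
    intro i j hij
    have h1 : L * u j ≤ ρ * u i := by
      rw [← heig' i]
      refine (mul_le_mul_of_nonneg_right (hentry i j hij).1 (hu j).le).trans ?_
      exact Finset.single_le_sum (f := fun j => A i j * u j)
        (fun l _ => mul_nonneg (hA.nonneg i l) (hu l).le) (Finset.mem_univ j)
    have h2 : ρ * u i ≤ (N * U) * u i := mul_le_mul_of_nonneg_right hρle (hu i).le
    rw [hr, div_mul_eq_mul_div, div_le_iff₀ hNU]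
    linarith
  -- The set grows strictly until it is everything, so `N` steps are enough.
  have hcard : ∀ k : ℕ,
      min N (k + 1) ≤ (Finset.univ.filter fun i => r ^ k / N ≤ u i).card := by
    intro k
    induction k with
    | zero =>
      obtain ⟨m, -, hm⟩ := Finset.exists_le_of_sum_le (s := (Finset.univ : Finset (Fin N)))
        (f := fun _ => (1 : ℝ) / N) (g := u) ⟨i, Finset.mem_univ i⟩
        (by rw [hsum]; simp; field_simp; simp)
      refine (min_le_right _ _).trans ?_
      rw [zero_add, Nat.one_le_iff_ne_zero, ← Nat.pos_iff_ne_zero, Finset.card_pos]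
      exact ⟨m, by simpa using hm⟩
    | succ k ih =>
      set S := Finset.univ.filter fun i => r ^ k / N ≤ u i
      have hsub : S ⊆ Finset.univ.filter fun i => r ^ (k + 1) / N ≤ u i := by
        intro l hl
        simp only [S, Finset.mem_filter, Finset.mem_univ, true_and] at hl ⊢
        refine le_trans ?_ hl
        gcongr 1
        exact pow_le_pow_of_le_one hr0.le hr1 k.le_succ
      by_cases hS : S = Finset.univ
      · refine (min_le_left _ _).trans ?_
        have := Finset.card_le_card hsub
        rwa [hS, Finset.card_univ, Fintype.card_fin] at this
      · have hSne : S.Nonempty := by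
          rw [← Finset.card_pos]
          omega
        obtain ⟨l, hl, j, hj, hlj⟩ := exists_ne_zero_of_isPrimitive hA hSne hS
        have hlt : S ⊂ Finset.univ.filter fun i => r ^ (k + 1) / N ≤ u i := by
          refine Finset.ssubset_iff_subset_ne.2 ⟨hsub, fun heq => hl ?_⟩
          rw [heq]
          simp only [S, Finset.mem_filter, Finset.mem_univ, true_and] at hj ⊢
          refine le_trans ?_ (hedge l j hlj)
          rw [pow_succ', mul_div_assoc]
          exact mul_le_mul_of_nonneg_left hj hr0.le
        have := Finset.card_lt_card hlt
        omega
  have hall : (Finset.univ.filter fun i => r ^ N / N ≤ u i) = Finset.univ := by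
    rw [← Finset.card_eq_iff_eq_univ, Fintype.card_fin]
    refine le_antisymm ((Finset.card_le_univ _).trans_eq (Fintype.card_fin N)) ?_
    simpa using hcard N
  have hi : i ∈ Finset.univ.filter (fun i => r ^ N / N ≤ u i) := hall.symm ▸ Finset.mem_univ i
  exact (Finset.mem_filter.1 hi).2

/-! ### The influence of the first observations -/

lemma mulVec_nonneg {m n : Type*} [Fintype n] {A : Matrix m n ℝ} (hA : ∀ i j, 0 ≤ A i j)
    {x : n → ℝ} (hx : ∀ j, 0 ≤ x j) (i : m) : 0 ≤ A.mulVec x i :=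
  Finset.sum_nonneg fun j _ => mul_nonneg (hA i j) (hx j)

lemma mulVec_mono {m n : Type*} [Fintype n] {A : Matrix m n ℝ} (hA : ∀ i j, 0 ≤ A i j)
    {x y : n → ℝ} (hxy : x ≤ y) : A.mulVec x ≤ A.mulVec y :=
  fun i => Finset.sum_le_sum fun j _ => mul_le_mul_of_nonneg_left (hxy j) (hA i j)

/-- The effect, up to the factor `σ⁻²`, on the products `ν̂_t ⊙ q_t` of adding the vector `e` to the
observations at time `0`. -/
noncomputable def influence {N : ℕ} (W : ℕ → Matrix (Fin N) (Fin N) ℝ) (e : Fin N → ℝ) :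
    ℕ → Fin N → ℝ
  | 0 => 0
  | t + 1 => e + (W t).mulVec (influence W e t)

lemma sum_influence_single {N : ℕ} (W : ℕ → Matrix (Fin N) (Fin N) ℝ) (t : ℕ) :
    ∑ j, influence W (Pi.single j 1) t = influence W 1 t := by
  induction t with
  | zero => simp [influence]
  | succ t ih =>
    simp only [influence, Finset.sum_add_distrib, ← Matrix.mulVec_sum, ih]
    congr 1
    ext i
    simp [Finset.sum_apply, Pi.single_apply]

lemma aggPrec_nonneg {N : ℕ} (σ : ℝ) {W : ℕ → Matrix (Fin N) (Fin N) ℝ}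
    (hW : ∀ t i j, 0 ≤ W t i j) {q0 : Fin N → ℝ} (hq0 : ∀ i, 0 ≤ q0 i) (t : ℕ) (i : Fin N) :
    0 ≤ aggPrec σ W q0 t i := by
  induction t generalizing i with
  | zero => exact hq0 i
  | succ t ih =>
    refine add_nonneg ?_ (mulVec_nonneg (hW t) ih i)
    unfold privPrec
    positivity

lemma aggPrec_succ_pos {N : ℕ} {σ : ℝ} (hσ : 0 < σ) {W : ℕ → Matrix (Fin N) (Fin N) ℝ}
    (hW : ∀ t i j, 0 ≤ W t i j) {q0 : Fin N → ℝ} (hq0 : ∀ i, 0 ≤ q0 i) (t : ℕ) (i : Fin N) :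
    0 < aggPrec σ W q0 (t + 1) i := by
  refine add_pos_of_pos_of_nonneg ?_ (mulVec_nonneg (hW t) (aggPrec_nonneg σ hW hq0 t) i)
  unfold privPrec
  positivity

lemma privMean_mul_privPrec {N : ℕ} (σ : ℝ) (o : ℕ → Fin N → ℝ) (t : ℕ) (i : Fin N) :
    privMean o (t + 1) i * privPrec σ (t + 1) =
      (σ ^ 2)⁻¹ * ∑ s ∈ Finset.range (t + 1), o s i := by
  unfold privMean privPrec
  have : ((t + 1 : ℕ) : ℝ) ≠ 0 := by positivity
  field_simp

/-- The precisions do not depend on the observations, so the difference of two runs satisfies the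
linear recursion of `influence`, driven by the difference of the observations at time `0`. -/
lemma aggMean_sub_mul_aggPrec {N : ℕ} {σ : ℝ} (hσ : 0 < σ)
    {W : ℕ → Matrix (Fin N) (Fin N) ℝ} (hW : ∀ t i j, 0 ≤ W t i j)
    {q0 : Fin N → ℝ} (hq0 : ∀ i, 0 ≤ q0 i) (ν0 : Fin N → ℝ) {o o' : ℕ → Fin N → ℝ}
    {d : ℝ} {e : Fin N → ℝ} (h0 : ∀ i, o 0 i - o' 0 i = d * e i)
    (hs : ∀ s, s ≠ 0 → ∀ i, o s i = o' s i) (t : ℕ) (i : Fin N) :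
    (aggMean σ W q0 ν0 o t i - aggMean σ W q0 ν0 o' t i) * aggPrec σ W q0 t i =
      d * (σ ^ 2)⁻¹ * influence W e t i := by
  induction t generalizing i with
  | zero => simp [aggMean, influence]
  | succ t ih =>
    have hq := (aggPrec_succ_pos hσ hW hq0 t i).ne'
    have hobs : ∑ s ∈ Finset.range (t + 1), o s i - ∑ s ∈ Finset.range (t + 1), o' s i
        = d * e i := by
      rw [← Finset.sum_sub_distrib, Finset.sum_range_succ', h0,
        Finset.sum_eq_zero fun s _ => sub_eq_zero.2 (hs (s + 1) s.succ_ne_zero i), zero_add]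
    have hmul : ∀ o : ℕ → Fin N → ℝ,
        aggMean σ W q0 ν0 o (t + 1) i * aggPrec σ W q0 (t + 1) i =
          (σ ^ 2)⁻¹ * ∑ s ∈ Finset.range (t + 1), o s i +
            ∑ j, W t i j * (aggMean σ W q0 ν0 o t j * aggPrec σ W q0 t j) := by
      intro o
      rw [← privMean_mul_privPrec]
      exact div_mul_cancel₀ _ hq
    have hW' : ∑ j, W t i j * (aggMean σ W q0 ν0 o t j * aggPrec σ W q0 t j) -
        ∑ j, W t i j * (aggMean σ W q0 ν0 o' t j * aggPrec σ W q0 t j) =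
          d * (σ ^ 2)⁻¹ * ∑ j, W t i j * influence W e t j := by
      rw [← Finset.sum_sub_distrib, Finset.mul_sum]
      refine Finset.sum_congr rfl fun j _ => ?_
      linear_combination W t i j * ih j
    have hinf : influence W e (t + 1) i = e i + ∑ j, W t i j * influence W e t j := rfl
    rw [sub_mul, hmul, hmul, hinf]
    linear_combination (σ ^ 2)⁻¹ * hobs + hW'

/-! ### Geometric growth of the influence -/

lemma influence_one_nonneg {N : ℕ} {W : ℕ → Matrix (Fin N) (Fin N) ℝ}
    (hW : ∀ t i j, 0 ≤ W t i j) (t : ℕ) (i : Fin N) : 0 ≤ influence W 1 t i := by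
  induction t generalizing i with
  | zero => exact le_rfl
  | succ t ih =>
    exact add_nonneg zero_le_one (mulVec_nonneg (hW t) ih i)

lemma influence_one_ge {N : ℕ} {W : ℕ → Matrix (Fin N) (Fin N) ℝ}
    (hW : ∀ t i j, 0 ≤ W t i j) {κ : ℝ} (hκ : 0 ≤ κ) {u : ℕ → Fin N → ℝ} (hu1 : u 0 ≤ 1)
    (hstep : ∀ t, κ • u (t + 1) ≤ (W (t + 1)).mulVec (u t)) (t : ℕ) :
    κ ^ t • u t ≤ influence W 1 (t + 1) := by
  induction t with
  | zero => simpa [influence] using hu1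
  | succ t ih =>
    calc κ ^ (t + 1) • u (t + 1) = κ ^ t • κ • u (t + 1) := by rw [pow_succ, mul_smul]
      _ ≤ κ ^ t • (W (t + 1)).mulVec (u t) :=
          smul_le_smul_of_nonneg_left (hstep t) (pow_nonneg hκ t)
      _ = (W (t + 1)).mulVec (κ ^ t • u t) := (Matrix.mulVec_smul _ _ _).symm
      _ ≤ (W (t + 1)).mulVec (influence W 1 (t + 1)) := mulVec_mono (hW _) ih
      _ ≤ influence W 1 (t + 1 + 1) := le_add_of_nonneg_left zero_le_one

/-- If `q_t ≤ C k_t`, then `q_{t+1} ≤ p_{t+1} + C k_{t+1}`, and `p_{t+1}` is a summable multiple of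
`k_{t+1}` by geometric growth. -/
lemma exists_aggPrec_le_mul_influence {N : ℕ} (σ : ℝ) {W : ℕ → Matrix (Fin N) (Fin N) ℝ}
    (hW : ∀ t i j, 0 ≤ W t i j) {q0 : Fin N → ℝ} (hq0 : ∀ i, 0 ≤ q0 i) {κ m : ℝ} (hκ : 1 < κ)
    (hm : 0 < m) (hgrow : ∀ t i, κ ^ t * m ≤ influence W 1 (t + 1) i) :
    ∃ C, ∀ t i, aggPrec σ W q0 (t + 1) i ≤ C * influence W 1 (t + 1) i := by
  set s : ℝ := (σ ^ 2)⁻¹ with hs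
  have hs0 : 0 ≤ s := by positivity
  -- `a t` bounds the private precision at time `t + 2` divided by the influence at that time.
  set a : ℕ → ℝ := fun t => s * (t + 2) / (κ ^ (t + 1) * m) with ha
  have ha0 : ∀ t, 0 ≤ a t := fun t => by positivity
  have hsummable : Summable a := by
    have hr : ‖κ⁻¹‖ < 1 := by
      rw [norm_inv, Real.norm_of_nonneg (by positivity)]
      exact inv_lt_one_of_one_lt₀ hκ
    have h1 := summable_pow_mul_geometric_of_norm_lt_one 1 hr
    have h2 := summable_geometric_of_norm_lt_one hr
    refine ((h1.add (h2.mul_left 2)).mul_left (s / (κ * m))).congr fun t => ?_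
    simp only [ha, pow_one, inv_pow]
    field_simp
    ring
  set C₁ : ℝ := ∑ i, aggPrec σ W q0 1 i with hC₁
  have key : ∀ t i, aggPrec σ W q0 (t + 1) i ≤
      (C₁ + ∑ k ∈ Finset.range t, a k) * influence W 1 (t + 1) i := by
    intro t
    induction t with
    | zero =>
      intro i
      have hinf : influence W 1 (0 + 1) i = 1 := by simp [influence]
      rw [hinf, Finset.sum_range_zero, add_zero, mul_one]
      exact Finset.single_le_sum (f := aggPrec σ W q0 1)
        (fun j _ => aggPrec_nonneg σ hW hq0 1 j) (Finset.mem_univ i)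
    | succ t ih =>
      intro i
      set C := C₁ + ∑ k ∈ Finset.range t, a k
      have hC : 0 ≤ C := add_nonneg (Finset.sum_nonneg fun j _ => aggPrec_nonneg σ hW hq0 1 j)
        (Finset.sum_nonneg fun k _ => ha0 k)
      have hprev : (W (t + 1)).mulVec (aggPrec σ W q0 (t + 1)) i ≤
          C * (W (t + 1)).mulVec (influence W 1 (t + 1)) i := by
        have := mulVec_mono (hW (t + 1)) (y := C • influence W 1 (t + 1)) ih i
        rwa [Matrix.mulVec_smul] at this
      have hinf : influence W 1 (t + 1 + 1) i =
          1 + (W (t + 1)).mulVec (influence W 1 (t + 1)) i := rfl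
      have hprivate : privPrec σ (t + 1 + 1) ≤ a t * influence W 1 (t + 1 + 1) i := by
        refine le_trans (le_of_eq ?_) (mul_le_mul_of_nonneg_left (hgrow (t + 1) i) (ha0 t))
        simp only [ha, privPrec, ← hs]
        rw [div_mul_cancel₀ _ (by positivity)]
        push_cast
        ring
      rw [Finset.sum_range_succ, ← add_assoc, add_mul]
      change privPrec σ (t + 1 + 1) + (W (t + 1)).mulVec (aggPrec σ W q0 (t + 1)) i ≤ _
      have : C * influence W 1 (t + 1 + 1) i =
          C + C * (W (t + 1)).mulVec (influence W 1 (t + 1)) i := by rw [hinf]; ring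
      linarith
  refine ⟨C₁ + ∑' k, a k, fun t i => (key t i).trans ?_⟩
  refine mul_le_mul_of_nonneg_right ?_ (influence_one_nonneg hW (t + 1) i)
  have := hsummable.sum_le_tsum (Finset.range t) fun k _ => ha0 k
  linarith

/-- A Perron vector whose `ℓ¹` normalization moves by at most `m (1 - 1/c) / 2` in each step, `m`
being a lower bound for the entries, provides the growth factor `(c + 1) / 2`. -/
lemma smul_le_mulVec_of_perron {N : ℕ} {A : Matrix (Fin N) (Fin N) ℝ} {c m ψ ρ : ℝ} (hc : 1 < c)
    (hψ : ψ ≤ m * (1 - 1 / c) / 2) (hρ : c ≤ ρ) {u u' : Fin N → ℝ}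
    (hu : ∀ i, 0 < u i) (heig : A.mulVec u = ρ • u) (hu' : ∀ i, m ≤ u' i)
    (hclose : ∑ i, |u' i - u i| ≤ ψ) : ((c + 1) / 2) • u' ≤ A.mulVec u := by
  intro i
  rw [heig]
  simp only [Pi.smul_apply, smul_eq_mul]
  have h1 : |u' i - u i| ≤ ψ :=
    (Finset.single_le_sum (f := fun i => |u' i - u i|) (fun _ _ => abs_nonneg _)
      (Finset.mem_univ i)).trans hclose
  have h2 : u' i - u i ≤ ψ := (le_abs_self _).trans h1
  have hc0 : 0 < c := by linarith
  have h3 : 0 ≤ 1 - 1 / c := by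
    rw [sub_nonneg, div_le_one hc0]
    exact hc.le
  have h4 : ψ ≤ u' i * (1 - 1 / c) / 2 :=
    hψ.trans (by have := mul_le_mul_of_nonneg_right (hu' i) h3; linarith)
  have h5 : c * ψ ≤ (c - 1) / 2 * u' i := by
    have := mul_le_mul_of_nonneg_left h4 hc0.le
    have h6 : c * (u' i * (1 - 1 / c) / 2) = (c - 1) / 2 * u' i := by field_simp
    linarith
  have h7 : c * u i ≤ ρ * u i := mul_le_mul_of_nonneg_right hρ (hu i).le
  nlinarith

/-! ### Null events for independent families -/

/-- If, all coordinates but `k` being fixed, at most one value of coordinate `k` leads to `B`, then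
an independent family whose `k`-th member has no atoms almost surely avoids `B`. -/
lemma measure_eq_zero_of_subsingleton_update {Ω ι : Type*} [MeasurableSpace Ω] [Countable ι]
    [DecidableEq ι] {P : Measure Ω} [IsProbabilityMeasure P] {X : ι → Ω → ℝ}
    (hX : ∀ i, AEMeasurable (X i) P) (hind : iIndepFun X P) (k : ι)
    [NullSingletonClass (P.map (X k))] {B : Set (ι → ℝ)} (hB : MeasurableSet B)
    (hsub : ∀ x, {s | Function.update x k s ∈ B}.Subsingleton) :
    P {ω | (fun i => X i ω) ∈ B} = 0 := by
  -- Measurable versions are needed for the generated σ-algebras to be independent sub-σ-algebras.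
  set Y : ι → Ω → ℝ := fun i => (hX i).mk (X i) with hY
  have hYm : ∀ i, Measurable (Y i) := fun i => (hX i).measurable_mk
  have hXY : ∀ i, X i =ᵐ[P] Y i := fun i => (hX i).ae_eq_mk
  have hindY : iIndepFun Y P := (iIndepFun_congr hXY).1 hind
  set G : Ω → ι → ℝ := fun ω => Function.update (fun i => Y i ω) k 0 with hG
  have hGm : Measurable G := by
    refine measurable_pi_lambda _ fun i => ?_
    by_cases hi : i = k
    · subst hi; simp [hG]
    · simpa [hG, hi] using hYm i
  have hindG : IndepFun (Y k) G P := by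
    have h := indep_iSup_of_disjoint (fun i => (hYm i).comap_le) hindY.iIndep
      (S := {k}) (T := {k}ᶜ) disjoint_compl_right
    rw [IndepFun_iff_Indep]
    refine indep_of_indep_of_le_left (indep_of_indep_of_le_right h ?_) ?_
    · rw [← measurable_iff_comap_le]
      refine (@measurable_pi_iff Ω ι (fun _ => ℝ) (_) _ G).2 fun i => ?_
      by_cases hi : i = k
      · subst hi; simp [hG]
      · simp only [hG, Function.update_of_ne hi]
        rw [measurable_iff_comap_le]
        exact le_iSup₂_of_le (f := fun i (_ : i ∈ ({k}ᶜ : Set ι)) =>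
          MeasurableSpace.comap (Y i) inferInstance) i hi le_rfl
    · exact le_iSup₂_of_le (f := fun i (_ : i ∈ ({k} : Set ι)) =>
        MeasurableSpace.comap (Y i) inferInstance) k rfl le_rfl
  have hadm : Measurable fun p : (ι → ℝ) × ℝ => Function.update p.1 k p.2 := by
    refine measurable_pi_lambda _ fun i => ?_
    by_cases hi : i = k
    · subst hi
      simpa using measurable_snd
    · simp only [Function.update_of_ne hi]
      exact (measurable_pi_apply i).comp measurable_fst
  have hXk : P.map (X k) = P.map (Y k) := Measure.map_congr (hXY k)
  have hae : ∀ᵐ ω ∂P, ∀ i, X i ω = Y i ω := ae_all_iff.2 hXY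
  have hset : {ω | (fun i => X i ω) ∈ B} =ᵐ[P] {ω | Function.update (G ω) k (Y k ω) ∈ B} := by
    filter_upwards [hae] with ω hω
    have : (fun i => X i ω) = Function.update (G ω) k (Y k ω) := by
      simp [hG, funext hω]
    exact congrArg (· ∈ B) this
  rw [measure_congr hset]
  have hpre : MeasurableSet ((fun p : (ι → ℝ) × ℝ => Function.update p.1 k p.2) ⁻¹' B) :=
    hadm hB
  have hmap := (indepFun_iff_map_prod_eq_prod_map_map hGm.aemeasurable
    (hYm k).aemeasurable).1 hindG.symm
  have hprod : (P.map G).prod (P.map (Y k))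
      ((fun p : (ι → ℝ) × ℝ => Function.update p.1 k p.2) ⁻¹' B) = 0 := by
    rw [← hXk]
    refine Measure.measure_prod_null_of_ae_null hpre (Eventually.of_forall fun x => ?_)
    exact (hsub x).measure_zero _
  rw [← hmap, Measure.map_apply (hGm.prodMk (hYm k)) hpre] at hprod
  exact hprod

lemma measurable_aggMean {N : ℕ} (σ : ℝ) (W : ℕ → Matrix (Fin N) (Fin N) ℝ)
    (q0 ν0 : Fin N → ℝ) (t : ℕ) (i : Fin N) :
    Measurable fun x : ℕ × Fin N → ℝ => aggMean σ W q0 ν0 (fun s j => x (s, j)) t i := by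
  induction t generalizing i with
  | zero => exact measurable_const
  | succ t ih =>
    simp only [aggMean, privMean, Matrix.mulVec, dotProduct]
    fun_prop

/-! ### Failure of convergence to the true mean -/

/-- The `ℓ¹` change of the normalized Perron vector per step that is tolerated: the lower bound of
`perron_lower_bound` for its entries times the relative loss that turns the growth factor `c` into
`(c + 1) / 2`. -/
noncomputable def stepBound (c L U : ℝ) (N : ℕ) : ℝ :=
  (L / (N * U)) ^ N / N * (1 - 1 / c) / 2

lemma stepBound_pos {c L U : ℝ} {N : ℕ} (hc : 1 < c) (hL : 0 < L) (hU : 0 < U) (hN : 0 < N) :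
    0 < stepBound c L U N := by
  have h1 : 0 < 1 - 1 / c := by
    rw [sub_pos, div_lt_one (by linarith)]
    exact hc
  have hN' : (0 : ℝ) < N := by exact_mod_cast hN
  unfold stepBound
  positivity

lemma exists_aggPrec_le_mul_influence_of_perron {N : ℕ} (σ : ℝ) {c L U : ℝ} (hc : 1 < c)
    (hL : 0 < L) (hLU : L < U) (hN : 0 < N) {W : ℕ → Matrix (Fin N) (Fin N) ℝ}
    {v : ℕ → Fin N → ℝ} (hW0 : ∀ i j, 0 ≤ W 0 i j) (hprim : ∀ t, 1 ≤ t → (W t).IsPrimitive)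
    (hperron : ∀ t, 1 ≤ t → IsPerronVector (W t) (v t)) (hrho : ∀ t, 1 ≤ t → c ≤ rho (W t))
    (hentry : ∀ t, 1 ≤ t → ∀ i j, W t i j ≠ 0 → L ≤ W t i j ∧ W t i j ≤ U)
    (hv : ∀ t, 1 ≤ t → vecNorm1
      ((vecNorm1 (v (t + 1)))⁻¹ • v (t + 1) - (vecNorm1 (v t))⁻¹ • v t) ≤ stepBound c L U N)
    {q0 : Fin N → ℝ} (hq0 : ∀ i, 0 ≤ q0 i) :
    ∃ C, ∀ t i, aggPrec σ W q0 (t + 1) i ≤ C * influence W 1 (t + 1) i := by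
  have hW : ∀ t i j, 0 ≤ W t i j := by
    intro t
    rcases Nat.eq_zero_or_pos t with rfl | ht
    · exact hW0
    · exact (hprim t ht).nonneg
  have : Nonempty (Fin N) := ⟨⟨0, hN⟩⟩
  -- The index is shifted because `W 0` need not have a Perron vector.
  set u : ℕ → Fin N → ℝ := fun t => (vecNorm1 (v (t + 1)))⁻¹ • v (t + 1) with hu
  have hvpos : ∀ t i, 0 < v (t + 1) i := fun t => (hperron (t + 1) t.succ_pos).1
  have hnorm : ∀ t, vecNorm1 (v (t + 1)) = ∑ i, v (t + 1) i := fun t =>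
    Finset.sum_congr rfl fun i _ => abs_of_pos (hvpos t i)
  have hnormpos : ∀ t, 0 < vecNorm1 (v (t + 1)) := fun t => by
    rw [hnorm]
    exact Finset.sum_pos (fun i _ => hvpos t i) Finset.univ_nonempty
  have hupos : ∀ t i, 0 < u t i := fun t i => mul_pos (inv_pos.2 (hnormpos t)) (hvpos t i)
  have husum : ∀ t, ∑ i, u t i = 1 := fun t => by
    simp only [hu, Pi.smul_apply, smul_eq_mul, ← Finset.mul_sum, ← hnorm]
    exact inv_mul_cancel₀ (hnormpos t).ne'
  have heig : ∀ t, (W (t + 1)).mulVec (u t) = rho (W (t + 1)) • u t := fun t => by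
    simp only [hu]
    rw [Matrix.mulVec_smul, (hperron (t + 1) t.succ_pos).2, smul_comm]
  set m : ℝ := (L / (N * U)) ^ N / N with hm
  have hmpos : 0 < m := by
    have hN' : (0 : ℝ) < N := by exact_mod_cast hN
    have hU : 0 < U := hL.trans hLU
    positivity
  have hmu : ∀ t i, m ≤ u t i := fun t => perron_lower_bound hL hLU (hprim (t + 1) t.succ_pos)
    (hentry (t + 1) t.succ_pos) (hupos t) (husum t) (heig t)
  have hu1 : u 0 ≤ 1 := fun i => by
    rw [Pi.one_apply, ← husum 0]
    exact Finset.single_le_sum (fun j _ => (hupos 0 j).le) (Finset.mem_univ i)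
  have hκ : 1 < (c + 1) / 2 := by linarith
  have hgrow := influence_one_ge hW (zero_le_one.trans hκ.le) hu1 fun t =>
    smul_le_mulVec_of_perron (ψ := stepBound c L U N) hc le_rfl (hrho (t + 1) t.succ_pos)
      (hupos t) (heig t) (hmu (t + 1)) (hv (t + 1) t.succ_pos)
  refine exists_aggPrec_le_mul_influence σ hW hq0 hκ hmpos fun t i => ?_
  exact (mul_le_mul_of_nonneg_left (hmu t i) (by positivity)).trans (hgrow t i)

/-- A first observation whose influence does not become negligible relative to the precision. -/
lemma exists_not_tendsto_influence_div {N : ℕ} {σ : ℝ} (hσ : 0 < σ)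
    {W : ℕ → Matrix (Fin N) (Fin N) ℝ} (hW : ∀ t i j, 0 ≤ W t i j) {q0 : Fin N → ℝ}
    (hq0 : ∀ i, 0 ≤ q0 i) {C : ℝ}
    (hC : ∀ t i, aggPrec σ W q0 (t + 1) i ≤ C * influence W 1 (t + 1) i) (i : Fin N) :
    ∃ j, ¬ Tendsto (fun t => influence W (Pi.single j 1) t i / aggPrec σ W q0 t i)
      atTop (𝓝 0) := by
  by_contra! h
  have hsum := (tendsto_finsetSum Finset.univ fun j _ => h j).const_mul C
  have hsingle : ∀ t, ∑ j, influence W (Pi.single j 1) t i = influence W 1 t i := fun t => by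
    rw [← sum_influence_single, Finset.sum_apply]
  simp only [← Finset.sum_div, hsingle, Finset.sum_const_zero, mul_zero] at hsum
  have hge : ∀ᶠ t in atTop, 1 ≤ C * (influence W 1 t i / aggPrec σ W q0 t i) := by
    filter_upwards [eventually_ge_atTop 1] with t ht
    obtain ⟨t, rfl⟩ := Nat.exists_eq_add_of_le' ht
    rw [← mul_div_assoc, one_le_div (aggPrec_succ_pos hσ hW hq0 t i)]
    exact hC t i
  exact absurd (ge_of_tendsto hsum hge) (by norm_num)

/-- With all other observations fixed, convergence to `μ` determines an observation whose influence
is not negligible. -/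
lemma subsingleton_update_tendsto {N : ℕ} {σ : ℝ} (hσ : 0 < σ)
    {W : ℕ → Matrix (Fin N) (Fin N) ℝ} (hW : ∀ t i j, 0 ≤ W t i j) {q0 : Fin N → ℝ}
    (hq0 : ∀ i, 0 ≤ q0 i) (ν0 : Fin N → ℝ) (μ : ℝ) {i j : Fin N}
    (hj : ¬ Tendsto (fun t => influence W (Pi.single j 1) t i / aggPrec σ W q0 t i)
      atTop (𝓝 0)) (x : ℕ × Fin N → ℝ) :
    {s | Function.update x (0, j) s ∈ {x : ℕ × Fin N → ℝ |
      Tendsto (fun t => aggMean σ W q0 ν0 (fun s j => x (s, j)) t i) atTop (𝓝 μ)}}.Subsingleton := by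
  intro s hs s' hs'
  by_contra hne
  refine hj ?_
  have hlim := ((Filter.Tendsto.sub hs hs').const_mul ((s - s')⁻¹ * σ ^ 2))
  rw [sub_self, mul_zero] at hlim
  refine hlim.congr' ?_
  filter_upwards [eventually_ge_atTop 1] with t ht
  obtain ⟨t, rfl⟩ := Nat.exists_eq_add_of_le' ht
  have hd := aggMean_sub_mul_aggPrec hσ hW hq0 ν0
    (o := fun r l => Function.update x (0, j) s (r, l))
    (o' := fun r l => Function.update x (0, j) s' (r, l)) (d := s - s') (e := Pi.single j 1)
    (fun l => by
      by_cases hl : l = j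
      · subst hl; simp
      · simp [hl])
    (fun r hr l => by simp [hr]) (t + 1) i
  have hq := (aggPrec_succ_pos hσ hW hq0 t i).ne'
  have hss : s - s' ≠ 0 := sub_ne_zero.2 hne
  rw [eq_div_iff hq, mul_assoc, hd]
  field_simp

end LockIn

theorem theorem2 :
    ∃ h : ℝ → ℝ → ℝ → ℕ → ℝ → ℝ,
      (∀ c L U N δ, 0 < h c L U N δ) ∧
      ∀ (N : ℕ) (c L U δ ε ψ : ℝ), 1 < c → 0 < L → L < U → 0 < δ → 0 < ε → 0 < ψ →
        -- the trust matrices and their Perron vectors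
        ∀ (W : ℕ → Matrix (Fin N) (Fin N) ℝ) (v : ℕ → Fin N → ℝ),
        (∀ i j, 0 ≤ W 0 i j) →
        (∀ t, 1 ≤ t → (W t).IsPrimitive) →
        (∀ t, 1 ≤ t → LockIn.IsPerronVector (W t) (v t)) →
        -- the five conditions on the trust matrices
        (∀ t, 1 ≤ t → LockIn.matNorm1 (W (t + 1) - W t) ≤ ε) →
        (∀ t, 1 ≤ t → c ≤ LockIn.rho (W t)) →
        (∀ t, 1 ≤ t → ∀ i j, W t i j ≠ 0 → L ≤ W t i j ∧ W t i j ≤ U) →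
        (∀ t, 1 ≤ t → LockIn.HasSpectralGap (W t) δ) →
        (∀ t, 1 ≤ t → LockIn.vecNorm1
          ((LockIn.vecNorm1 (v (t + 1)))⁻¹ • v (t + 1) - (LockIn.vecNorm1 (v t))⁻¹ • v t) ≤ ψ) →
        ε < h c L U N δ → ψ < h c L U N δ →
        -- the observations: independent, with law `N(μ, σ²)`
        ∀ {Ω : Type*} [MeasurableSpace Ω] (P : Measure Ω) [IsProbabilityMeasure P]
          (μ σ : ℝ) (o : ℕ → Fin N → Ω → ℝ), 0 < σ →
        (∀ t i, HasLaw (o t i) (gaussianReal μ ⟨σ ^ 2, sq_nonneg σ⟩) P) →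
        iIndepFun (fun (p : ℕ × Fin N) => o p.1 p.2) P →
        -- the initial aggregate beliefs
        ∀ (q0 ν0 : Fin N → ℝ), (∀ i, 0 ≤ q0 i) →
        ∀ i : Fin N,
          P {ω | Tendsto (fun t => LockIn.aggMean σ W q0 ν0 (fun s j => o s j ω) t i)
            atTop (𝓝 μ)} = 0 := by
  -- Outside the range of parameters in which `stepBound` is positive any positive value will do.
  refine ⟨fun c L U N _ => if 0 < LockIn.stepBound c L U N then LockIn.stepBound c L U N else 1,
    fun c L U N δ => ?_, ?_⟩
  · dsimp only
    split_ifs with h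
    exacts [h, one_pos]
  intro N c L U δ ε ψ hc hL hLU _ _ _ W v hW0 hprim hperron _ hrho hentry _ hv _ hψ Ω _ P _ μ σ o
    hσ hlaw hind q0 ν0 hq0 i
  have hN : 0 < N := i.pos
  dsimp only at hψ
  rw [if_pos (LockIn.stepBound_pos hc hL (hL.trans hLU) hN)] at hψ
  have hW : ∀ t i j, 0 ≤ W t i j := by
    intro t
    rcases Nat.eq_zero_or_pos t with rfl | ht
    · exact hW0
    · exact (hprim t ht).nonneg
  obtain ⟨C, hC⟩ := LockIn.exists_aggPrec_le_mul_influence_of_perron σ hc hL hLU hN hW0 hprim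
    hperron hrho hentry (fun t ht => (hv t ht).trans hψ.le) hq0
  obtain ⟨j, hj⟩ := LockIn.exists_not_tendsto_influence_div hσ hW hq0 hC i
  have hvar : (⟨σ ^ 2, sq_nonneg σ⟩ : NNReal) ≠ 0 := fun h =>
    (pow_pos hσ 2).ne' (congrArg NNReal.toReal h)
  have : NullSingletonClass (P.map (o 0 j)) := by
    rw [(hlaw 0 j).map_eq]
    exact nullSingletonClass_gaussianReal hvar
  exact LockIn.measure_eq_zero_of_subsingleton_update (X := fun p : ℕ × Fin N => o p.1 p.2)
    (fun p => (hlaw p.1 p.2).aemeasurable) hind (0, j)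
    (measurableSet_tendsto (𝓝 μ) fun t => LockIn.measurable_aggMean σ W q0 ν0 t i)
    (LockIn.subsingleton_update_tendsto hσ hW hq0 ν0 μ hj)
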